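/- Let $\mathbb{N}^*$ denote the set of positive integers. Let $Q\subsetneq\mathbb{N}^*$ be an infinite set which is $\mathbb{N}^*\backslash Q$-free, that is, such that for every $q\in\mathbb{N}^*$ one has $q\in Q$ if and only if no $v\in\mathbb{N}^*\backslash Q$ divides $q$. Let $$\nu(Q)=\inf\Big\{\nu>0 : \sum_{q\in Q}q^{-\nu}<\infty\Big\}\in[0,1]$$ be its exponent of convergence. For an integer $n\ge 1$, a real number $\tau$ and a set $S\subseteq\mathbb{N}^*$, let $W_{\tau,n}(S)$ be the set of all $(x_1,\dots,x_n)\in\mathbb{R}^n$ for which there are infinitely many $q\in S$ such that, for some integers $p_1,\dots,p_n$, $|x_i-p_i/q|<q^{-\tau}$ for all $1\le i\le n$. Put $W_{\tau,n}=W_{\tau,n}(\mathbb{N}^*)$ and $W^*_{\tau,n}(Q)=W_{\tau,n}\backslash W_{\tau,n}(Q)$; equivalently, $W^*_{\tau,n}(Q)$ is the set of points that are $\tau$-approximable in this sense by infinitely many denominators $q\in\mathbb{N}^*\backslash Q$ and by only finitely many $q\in Q$. Let $\dim$ denote Hausdorff dimension. Then: 1. If $\nu(Q)<1$, $n\ge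 1$ and $\tau>1+1/n$, then $\dim W^*_{\tau,n}(Q)=(n+1)/\tau$. 2. If $\nu(Q)=1$, $n\ge 2$ and $\tau>1+1/(n-1)$, then $n/\tau\le\dim W^*_{\tau,n}(Q)\le(n+1)/\tau$. 3. If $n\ge 2$ and $\tau>1+1/(n-1)$, then for all non-negative integers $a_1,\dots,a_n$, not all zero, and all coprime $u,v\in\mathbb{N}^*$ with $v\notin Q$, the set of points of $W_{\tau,n}$ lying on the hyperplane $\sum_{i=1}^n a_ix_i=u/v$ is contained in $W^*_{\tau,n}(Q)$ and has Hausdorff dimension at least $n/\tau$. -/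

import Mathlib

open Set

/-- For a set `Q` of positive integers: `Q` is `ℕ* \ Q`-free, i.e. a positive integer `q` belongs to
`Q` if and only if no positive integer outside `Q` divides `q`. -/
def IsComplementFree (Q : Set ℕ) : Prop :=
  ∀ q : ℕ, 0 < q → (q ∈ Q ↔ ∀ v : ℕ, 0 < v → v ∉ Q → ¬ v ∣ q)

/-- The exponent of convergence `ν(Q) = inf {ν > 0 : ∑_{q ∈ Q} q ^ (-ν) < ∞}`. -/
noncomputable def convergenceExponent (Q : Set ℕ) : ℝ :=
  sInf {ν : ℝ | 0 < ν ∧ Summable (fun q : Q => ((q : ℕ) : ℝ) ^ (-ν))}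

/-- The integer `q` is the common denominator of fractions `p₁/q, …, pₙ/q` (not necessarily in lowest
terms) such that `|xᵢ - pᵢ/q| < 1/q^τ` for all `i`. -/
def IsApproxDenom {n : ℕ} (τ : ℝ) (x : Fin n → ℝ) (q : ℕ) : Prop :=
  ∃ p : Fin n → ℤ, ∀ i, |x i - (p i : ℝ) / (q : ℝ)| < 1 / (q : ℝ) ^ τ

/-- `W_{τ,n}(Q)`: points simultaneously `τ`-approximable by infinitely many denominators in `Q`.
The ambient space `Fin n → ℝ` is `ℝⁿ` with the sup norm; Hausdorff dimension does not depend on the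
choice of the norm on `ℝⁿ`. -/
def approxSetIn (τ : ℝ) (n : ℕ) (Q : Set ℕ) : Set (Fin n → ℝ) :=
  {x | {q : ℕ | q ∈ Q ∧ IsApproxDenom τ x q}.Infinite}

/-- `W_{τ,n}`: points simultaneously `τ`-approximable by infinitely many denominators `q ≥ 1`. -/
def approxSet (τ : ℝ) (n : ℕ) : Set (Fin n → ℝ) :=
  approxSetIn τ n {q : ℕ | 0 < q}

/-- `W*_{τ,n}(Q) = W_{τ,n} \ W_{τ,n}(Q)`. -/
def approxSetStar (τ : ℝ) (n : ℕ) (Q : Set ℕ) : Set (Fin n → ℝ) :=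
  approxSet τ n \ approxSetIn τ n Q

/-- `W*_{τ,n}(Q)` consists of the points that are `τ`-approximable by infinitely many denominators
outside `Q` and only finitely many inside `Q`. -/
theorem mem_approxSetStar_iff (τ : ℝ) (n : ℕ) (Q : Set ℕ) (x : Fin n → ℝ) :
    x ∈ approxSetStar τ n Q ↔
      {q : ℕ | 0 < q ∧ q ∉ Q ∧ IsApproxDenom τ x q}.Infinite ∧
        {q : ℕ | q ∈ Q ∧ IsApproxDenom τ x q}.Finite := by
  simp only [approxSetStar, approxSet, approxSetIn, mem_sdiff, mem_ofPred_eq, not_infinite]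
  refine and_congr_left fun hf => ⟨fun h hg => h ?_, fun h => h.mono ?_⟩
  · refine (hf.union hg).subset fun q hq => ?_
    by_cases hQ : q ∈ Q
    · exact Or.inl ⟨hQ, hq.2⟩
    · exact Or.inr ⟨hq.1, hQ, hq.2⟩
  · exact fun q hq => ⟨hq.1, hq.2.2⟩

/-- The rational hyperplane `∑ aᵢ xᵢ = u / v` in `ℝⁿ`. -/
def rationalHyperplane {n : ℕ} (a : Fin n → ℕ) (u v : ℕ) : Set (Fin n → ℝ) :=
  {x | ∑ i, (a i : ℝ) * x i = (u : ℝ) / (v : ℝ)}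

/-! Let `x` lie on the hyperplane `∑ aᵢ xᵢ = u / v` with `v ∉ Q`, and let `p / q` approximate it to
order `τ > 1`. The integer `u q - v ∑ aᵢ pᵢ` is `O(q ^ (1 - τ))`, so it vanishes for large `q`; then
`v ∣ q` by coprimality, hence `q ∉ Q`. Thus every approximable point of the hyperplane lies in `W*`.
The hyperplane is a graph over `n - 1` coordinates with rational coefficients, so approximations of
those coordinates lift with a bounded factor in the denominator, and the Jarník–Besicovitch theorem
in dimension `n - 1` gives `n / τ`.

If `ν(Q) < 1`, covering shows that `W(Q)` has dimension at most `(n + ν) / τ < (n + 1) / τ` for some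
`ν < 1`. Removing it from `W` therefore does not lower the dimension.

The remaining ingredient is the Jarník–Besicovitch lower bound. Dirichlet's theorem and a volume
count give, in any ball of fixed radius `r` and for all large `H`, about `(r H ^ (m + 1)) ^ m`
rational points with denominators comparable to `H ^ m` and mutual distances at least `H ^ (-(m +
1))`. Iterating with rapidly growing `H` builds a Cantor set inside `W`, whose dimension is bounded
below by the mass distribution principle. -/

open MeasureTheory Filter Topology Metric
open scoped NNReal ENNReal

/-! ### Hausdorff measure tools. -/

/-- Mass distribution principle, for the image of a measure under an arbitrary map. -/
theorem le_dimH_range_of_measure_preimage_le {Ω Y : Type*} [MeasurableSpace Ω] [EMetricSpace Y]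
    (μ : Measure Ω) (hμ : μ univ ≠ 0) (g : Ω → Y) (s : ℝ≥0) (δ : ℝ≥0∞) (hδ : 0 < δ)
    (h : ∀ U : Set Y, ediam U ≤ δ → μ (g ⁻¹' U) ≤ ediam U ^ (s : ℝ)) :
    (s : ℝ≥0∞) ≤ dimH (range g) := by
  borelize Y
  refine le_dimH_of_hausdorffMeasure_ne_zero fun h0 => hμ ?_
  -- Pushing forward as an outer measure avoids any measurability of `g`; `mkMetric` is the largest
  -- outer measure dominated by the gauge on small sets.
  have hle : OuterMeasure.map g μ.toOuterMeasure ≤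
      OuterMeasure.mkMetric (fun r : ℝ≥0∞ => r ^ (s : ℝ)) :=
    OuterMeasure.le_mkMetric _ _ δ hδ h
  have h1 := hle (range g)
  rw [OuterMeasure.map_apply, preimage_range, ← Measure.mkMetric_toOuterMeasure] at h1
  exact le_antisymm (h1.trans h0.le) bot_le

/-- Convergence half of the Borel–Cantelli lemma for Hausdorff measures. -/
theorem hausdorffMeasure_setOf_infinite_eq_zero {X ι : Type*} [EMetricSpace X] [MeasurableSpace X]
    [BorelSpace X] [Countable ι] (B : ι → Set X) {d : ℝ} (hd : 0 < d)
    (h : ∑' i, ediam (B i) ^ d ≠ ∞) :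
    μH[d] {x | {i | x ∈ B i}.Infinite} = 0 := by
  have hlim := ENNReal.tendsto_tsum_compl_atTop_zero h
  have hr : Tendsto (fun F : Finset ι => (∑' i : { i // i ∉ F }, ediam (B i) ^ d) ^ (1 / d))
      atTop (𝓝 0) := by
    have := (ENNReal.continuous_rpow_const (y := 1 / d)).tendsto 0 |>.comp hlim
    rwa [ENNReal.zero_rpow_of_pos (by positivity)] at this
  have key := Measure.hausdorffMeasure_le_liminf_tsum d {x | {i | x ∈ B i}.Infinite} _ hr
    (fun (F : Finset ι) (i : { i // i ∉ F }) => B i)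
    (Eventually.of_forall fun F i => by
      have h1 : ediam (B i) ^ d ≤ ∑' i : { i // i ∉ F }, ediam (B i) ^ d :=
        ENNReal.le_tsum (f := fun i : { i // i ∉ F } => ediam (B i) ^ d) i
      calc ediam (B i) = (ediam (B i) ^ d) ^ (1 / d) := by
            rw [← ENNReal.rpow_mul, mul_one_div_cancel hd.ne', ENNReal.rpow_one]
        _ ≤ _ := ENNReal.rpow_le_rpow h1 (by positivity))
    (Eventually.of_forall fun F x hx => by
      obtain ⟨i, hi, hiF⟩ := hx.exists_notMem_finset F
      exact mem_iUnion.2 ⟨⟨i, hiF⟩, hi⟩)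
  rw [hlim.liminf_eq] at key
  exact le_antisymm key bot_le

/-! ### Dirichlet's theorem and integer points in boxes. -/

/-- Dirichlet's theorem on simultaneous approximation. -/
theorem exists_simultaneous_approx {m : ℕ} (x : Fin m → ℝ) {H : ℕ} (hH : 0 < H) :
    ∃ q : ℕ, 0 < q ∧ q ≤ H ^ m ∧ ∃ p : Fin m → ℤ, ∀ i, |(q : ℝ) * x i - p i| ≤ 1 / H := by
  have hH' : (0 : ℝ) < H := by exact_mod_cast hH
  have hlt : ∀ t : ℝ, ⌊(H : ℝ) * Int.fract t⌋₊ < H := fun t => by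
    rw [Nat.floor_lt (mul_nonneg hH'.le (Int.fract_nonneg _))]
    nlinarith [Int.fract_lt_one t]
  -- Pigeonhole: `H ^ m + 1` multiples of `x` modulo 1 fall into `H ^ m` cells of side `1 / H`.
  let f : Fin (H ^ m + 1) → (Fin m → Fin H) := fun k i => ⟨⌊(H : ℝ) * Int.fract (k * x i)⌋₊, hlt _⟩
  have main : ∀ k l : Fin (H ^ m + 1), k < l → f k = f l → ∃ q : ℕ, 0 < q ∧ q ≤ H ^ m ∧
      ∃ p : Fin m → ℤ, ∀ i, |(q : ℝ) * x i - p i| ≤ 1 / H := by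
    intro k l hkl hf
    refine ⟨(l : ℕ) - k, Nat.sub_pos_of_lt hkl, (Nat.sub_le _ _).trans (Nat.lt_succ_iff.1 l.2),
      fun i => ⌊(l : ℝ) * x i⌋ - ⌊(k : ℝ) * x i⌋, fun i => ?_⟩
    have hi : ⌊(H : ℝ) * Int.fract (k * x i)⌋₊ = ⌊(H : ℝ) * Int.fract (l * x i)⌋₊ :=
      congrArg Fin.val (congrFun hf i)
    have nn : ∀ t : ℝ, 0 ≤ (H : ℝ) * Int.fract t := fun t => mul_nonneg hH'.le (Int.fract_nonneg _)
    have h1 := Nat.floor_le (nn (k * x i))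
    have h2 := Nat.lt_floor_add_one ((H : ℝ) * Int.fract (k * x i))
    have h3 := Nat.floor_le (nn (l * x i))
    have h4 := Nat.lt_floor_add_one ((H : ℝ) * Int.fract (l * x i))
    rw [← hi] at h3 h4
    have e1 := Int.self_sub_floor ((k : ℝ) * x i)
    have e2 := Int.self_sub_floor ((l : ℝ) * x i)
    rw [Nat.cast_sub hkl.le]
    push_cast
    have : ((l : ℝ) - k) * x i - (⌊(l : ℝ) * x i⌋ - ⌊(k : ℝ) * x i⌋) =
        Int.fract (l * x i) - Int.fract (k * x i) := by rw [← e1, ← e2]; ring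
    rw [this, le_div_iff₀ hH', ← abs_of_pos hH', ← abs_mul, abs_le]
    constructor <;> nlinarith
  obtain ⟨k, l, hkl, hf⟩ := Fintype.exists_ne_map_eq_of_card_lt f (by simp)
  rcases lt_or_gt_of_ne hkl with h | h
  · exact main k l h hf
  · exact main l k h hf.symm

/-- The integer points at sup-distance at most `L` from `a`. -/
noncomputable def intBox {m : ℕ} (a : Fin m → ℝ) (L : ℝ) : Finset (Fin m → ℤ) :=
  Fintype.piFinset fun i => Finset.Icc ⌈a i - L⌉ ⌊a i + L⌋

theorem mem_intBox {m : ℕ} {a : Fin m → ℝ} {L : ℝ} {p : Fin m → ℤ} :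
    p ∈ intBox a L ↔ ∀ i, |(p i : ℝ) - a i| ≤ L := by
  simp only [intBox, Fintype.mem_piFinset, Finset.mem_Icc, Int.ceil_le, Int.le_floor, abs_le]
  refine forall_congr' fun i => and_congr ?_ ?_ <;> constructor <;> intro h <;> linarith

theorem card_intBox_le {m : ℕ} (a : Fin m → ℝ) {L : ℝ} (hL : 0 ≤ L) :
    ((intBox a L).card : ℝ) ≤ (2 * L + 1) ^ m := by
  rw [intBox, Fintype.card_piFinset, Nat.cast_prod]
  have : ∀ i, ((Finset.Icc ⌈a i - L⌉ ⌊a i + L⌋).card : ℝ) ≤ 2 * L + 1 := fun i => by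
    rw [Int.card_Icc]
    have h1 := Int.floor_le (a i + L)
    have h2 := Int.le_ceil (a i - L)
    have h3 : ((⌊a i + L⌋ + 1 - ⌈a i - L⌉ : ℤ) : ℝ) ≤ 2 * L + 1 := by push_cast; linarith
    rcases le_total 0 (⌊a i + L⌋ + 1 - ⌈a i - L⌉) with h | h
    · have : (((⌊a i + L⌋ + 1 - ⌈a i - L⌉).toNat : ℤ) : ℝ) ≤ 2 * L + 1 := by
        rwa [Int.toNat_of_nonneg h]
      exact_mod_cast this
    · rw [Int.toNat_of_nonpos h]; push_cast; linarith
  calc ∏ i, ((Finset.Icc ⌈a i - L⌉ ⌊a i + L⌋).card : ℝ) ≤ ∏ _i : Fin m, (2 * L + 1) :=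
        Finset.prod_le_prod (fun i _ => by positivity) fun i _ => this i
    _ = _ := by simp

/-! ### Upper bound from the natural cover. -/

/-- In a bounded region each `q` contributes `O(q ^ n)` balls of radius `q ^ (-τ)`. With `s = (n +
ν) / τ` their `s`-th powers of diameters sum to `O(q ^ (n - s τ)) = O(q ^ (-ν))`, so Borel–Cantelli
applies at `s` itself. -/
theorem dimH_approxSetIn_le (n : ℕ) {τ : ℝ} (hτ : 0 < τ) {Q : Set ℕ} (hQ : ∀ q ∈ Q, 0 < q)
    {ν : ℝ} (hν : 0 < ν) (hsum : Summable fun q : Q => ((q : ℕ) : ℝ) ^ (-ν)) :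
    dimH (approxSetIn τ n Q) ≤ ENNReal.ofReal ((n + ν) / τ) := by
  set s : ℝ := (n + ν) / τ with hs
  have hs0 : 0 < s := by positivity
  have hcover : approxSetIn τ n Q ⊆ ⋃ R : ℕ, approxSetIn τ n Q ∩ closedBall 0 R := fun x hx => by
    obtain ⟨R, hR⟩ := exists_nat_ge (dist x 0)
    exact mem_iUnion.2 ⟨R, hx, hR⟩
  refine (dimH_mono hcover).trans ?_
  rw [dimH_iUnion]
  refine iSup_le fun R => ?_
  refine dimH_le_of_hausdorffMeasure_ne_top (d := s.toNNReal) ?_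
  rw [Real.coe_toNNReal s hs0.le]
  let ι := Σ q : Q, { p : Fin n → ℤ // p ∈ intBox (0 : Fin n → ℝ) ((R + 1) * (q : ℕ)) }
  let B : ι → Set (Fin n → ℝ) := fun i =>
    closedBall (fun j => (i.2.1 j : ℝ) / (i.1 : ℕ)) (((i.1 : ℕ) : ℝ) ^ (-τ))
  have hsub : approxSetIn τ n Q ∩ closedBall 0 R ⊆ {x | {i | x ∈ B i}.Infinite} := by
    rintro x ⟨hx, hxR⟩
    refine Infinite.of_image (fun i : ι => (i.1 : ℕ)) (Infinite.mono ?_ hx)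
    rintro q ⟨hq, p, hp⟩
    have hq0 : (0 : ℝ) < q := by exact_mod_cast hQ q hq
    have hq1 : (1 : ℝ) ≤ q := by exact_mod_cast hQ q hq
    have hp' : ∀ i, |x i - (p i : ℝ) / q| < (q : ℝ) ^ (-τ) := fun i => by
      rw [Real.rpow_neg hq0.le, inv_eq_one_div]; exact hp i
    refine ⟨⟨⟨q, hq⟩, p, mem_intBox.2 fun i => ?_⟩, ?_, rfl⟩
    · have h1 : |x i| ≤ R := by
        have := (norm_le_pi_norm x i).trans (mem_closedBall_zero_iff.1 hxR)
        simpa using this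
      have h2 := (hp' i).le.trans (Real.rpow_le_one_of_one_le_of_nonpos hq1 (by linarith))
      have h3 : |(p i : ℝ) / q| ≤ R + 1 := by
        rw [abs_le] at *; constructor <;> linarith
      rw [abs_div, abs_of_pos hq0, div_le_iff₀ hq0] at h3
      simpa using h3
    · refine (dist_pi_le_iff (by positivity)).2 fun i => ?_
      rw [Real.dist_eq]; exact (hp' i).le
  have hfin : ∑' i, ediam (B i) ^ s ≠ ∞ := by
    have hle : ∀ q : Q, ∑' p : { p : Fin n → ℤ // p ∈ intBox (0 : Fin n → ℝ) ((R + 1) * (q : ℕ)) },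
        ediam (B ⟨q, p⟩) ^ s ≤
          ENNReal.ofReal (((2 * (R + 1) + 1) ^ n * 2 ^ s) * ((q : ℕ) : ℝ) ^ (-ν)) := fun q => by
      have hq0 : (0 : ℝ) < (q : ℕ) := by exact_mod_cast hQ q q.2
      have hq1 : (1 : ℝ) ≤ (q : ℕ) := by exact_mod_cast hQ q q.2
      have hB : ∀ p, ediam (B ⟨q, p⟩) ^ s ≤ ENNReal.ofReal ((2 * ((q : ℕ) : ℝ) ^ (-τ)) ^ s) :=
        fun p => by
          rw [← ENNReal.ofReal_rpow_of_nonneg (by positivity) hs0.le]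
          refine ENNReal.rpow_le_rpow ?_ hs0.le
          refine ediam_le_of_forall_dist_le fun x hx y hy => ?_
          have hx' := mem_closedBall.1 hx
          have hy' := mem_closedBall'.1 hy
          exact (dist_triangle _ _ _).trans (by linarith)
      have hpow : (2 * ((q : ℕ) : ℝ) ^ (-τ)) ^ s =
          2 ^ s * (((q : ℕ) : ℝ) ^ (-ν) / ((q : ℕ) : ℝ) ^ n) := by
        rw [Real.mul_rpow (by norm_num) (by positivity), ← Real.rpow_mul hq0.le,
          ← Real.rpow_natCast, ← Real.rpow_sub hq0]
        congr 2
        rw [hs]; field_simp; ring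
      refine (ENNReal.tsum_le_tsum hB).trans ?_
      rw [tsum_fintype, Finset.sum_const, Finset.card_univ, Fintype.card_coe, nsmul_eq_mul,
        ← ENNReal.ofReal_natCast, ← ENNReal.ofReal_mul (by positivity)]
      refine ENNReal.ofReal_le_ofReal ?_
      have hc := card_intBox_le (0 : Fin n → ℝ) (L := (R + 1) * (q : ℕ)) (by positivity)
      have hc2 : (2 * (((R : ℝ) + 1) * (q : ℕ)) + 1) ^ n ≤
          (2 * (R + 1) + 1) ^ n * ((q : ℕ) : ℝ) ^ n := by
        rw [← mul_pow]
        refine pow_le_pow_left₀ (by positivity) ?_ n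
        nlinarith
      calc _ ≤ ((2 * (R + 1) + 1) ^ n * ((q : ℕ) : ℝ) ^ n) *
            (2 ^ s * (((q : ℕ) : ℝ) ^ (-ν) / ((q : ℕ) : ℝ) ^ n)) := by
            rw [hpow]; exact mul_le_mul_of_nonneg_right (hc.trans hc2) (by positivity)
        _ = _ := by field_simp
    rw [ENNReal.tsum_sigma']
    refine ne_top_of_le_ne_top ?_ (ENNReal.tsum_le_tsum hle)
    exact (hsum.mul_left _).tsum_ofReal_ne_top
  have := hausdorffMeasure_setOf_infinite_eq_zero B hs0 hfin
  exact ((measure_mono hsub).trans_lt (this ▸ ENNReal.zero_lt_top)).ne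

/-! ### Separated families of rational points. -/

/-- The balls of radius `d / 2` about the points are disjoint and lie in one ball of radius `ρ + d /
2`; compare volumes. -/
theorem card_mul_pow_le_of_separated {ι : Type*} {m : ℕ} (J : Finset ι) (c : ι → Fin m → ℝ)
    {d ρ : ℝ} (hd : 0 < d) (hρ : 0 ≤ ρ) (x : Fin m → ℝ) (hc : ∀ i ∈ J, dist (c i) x ≤ ρ)
    (hsep : ∀ i ∈ J, ∀ j ∈ J, i ≠ j → d ≤ dist (c i) (c j)) :
    (J.card : ℝ) * d ^ m ≤ (2 * ρ + d) ^ m := by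
  have hdisj : (J : Set ι).PairwiseDisjoint fun i => ball (c i) (d / 2) := fun i hi j hj hij =>
    ball_disjoint_ball (by linarith [hsep i hi j hj hij])
  have hsub : (⋃ i ∈ J, ball (c i) (d / 2)) ⊆ closedBall x (ρ + d / 2) := by
    refine iUnion₂_subset fun i hi => ball_subset_closedBall.trans (closedBall_subset_closedBall' ?_)
    linarith [hc i hi]
  have h := measure_mono (μ := volume) hsub
  rw [measure_biUnion_finset hdisj fun i _ => measurableSet_ball,
    Real.volume_pi_closedBall _ (by positivity)] at h
  simp_rw [Real.volume_pi_ball _ (half_pos hd)] at h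
  rw [Finset.sum_const, nsmul_eq_mul, ← ENNReal.ofReal_natCast,
    ← ENNReal.ofReal_mul (by positivity), ENNReal.ofReal_le_ofReal_iff (by positivity),
    Fintype.card_fin] at h
  convert h using 3 <;> ring

/-- A greedily built maximal `d`-separated subset is automatically a `d`-net. -/
theorem exists_separated_subset {X : Type*} [PseudoMetricSpace X] (T : Finset X) {d : ℝ}
    (hd : 0 < d) :
    ∃ P ⊆ T, (∀ y ∈ P, ∀ z ∈ P, y ≠ z → d ≤ dist y z) ∧ ∀ y ∈ T, ∃ z ∈ P, dist y z < d := by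
  classical
  induction T using Finset.induction_on with
  | empty => exact ⟨∅, subset_rfl, by simp, by simp⟩
  | insert a T _ ih =>
    obtain ⟨P, hPT, hsep, hcov⟩ := ih
    by_cases h : ∃ z ∈ P, dist a z < d
    · refine ⟨P, hPT.trans (Finset.subset_insert _ _), hsep, fun y hy => ?_⟩
      rcases Finset.mem_insert.1 hy with rfl | hy
      exacts [h, hcov y hy]
    · push Not at h
      refine ⟨insert a P, Finset.insert_subset_insert _ hPT, ?_, fun y hy => ?_⟩
      · intro y hy z hz hyz
        rcases Finset.mem_insert.1 hy with rfl | hyP <;>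
          rcases Finset.mem_insert.1 hz with rfl | hzP
        · exact absurd rfl hyz
        · exact h z hzP
        · rw [dist_comm]; exact h y hyP
        · exact hsep y hyP z hzP hyz
      · rcases Finset.mem_insert.1 hy with rfl | hy
        · exact ⟨y, Finset.mem_insert_self _ _, by simpa using hd⟩
        · obtain ⟨z, hz, hyz⟩ := hcov y hy
          exact ⟨z, Finset.mem_insert_of_mem hz, hyz⟩

/-- Denominators `q ≥ 6 / r` contribute at most `(3 r) ^ m` each. The at most `6 / r` others
contribute at most `8 ^ m` each, a total independent of `K` that a large `H ^ m` will absorb. -/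
theorem sum_pow_le {m : ℕ} {r : ℝ} (hr : 0 < r) (hr1 : r ≤ 1) (K : ℕ) :
    ∑ q ∈ Finset.Icc 1 K, (2 * r + 6 / (q : ℝ)) ^ m ≤ K * (3 * r) ^ m + 6 / r * 8 ^ m := by
  have hterm : ∀ q ∈ Finset.Icc 1 K, (2 * r + 6 / (q : ℝ)) ^ m ≤
      (3 * r) ^ m + if (q : ℝ) < 6 / r then 8 ^ m else 0 := fun q hq => by
    have hq1 : (1 : ℝ) ≤ q := by exact_mod_cast (Finset.mem_Icc.1 hq).1
    split_ifs with h
    · have : 6 / (q : ℝ) ≤ 6 := div_le_self (by norm_num) hq1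
      have := pow_le_pow_left₀ (by positivity) (show 2 * r + 6 / (q : ℝ) ≤ 8 by linarith) m
      have : 0 ≤ (3 * r) ^ m := by positivity
      linarith
    · rw [add_zero]
      refine pow_le_pow_left₀ (by positivity) ?_ m
      have : 6 / (q : ℝ) ≤ r := by
        rw [not_lt, div_le_iff₀ hr] at h
        rw [div_le_iff₀ (by positivity)]; linarith
      linarith
  refine (Finset.sum_le_sum hterm).trans ?_
  rw [Finset.sum_add_distrib, Finset.sum_const, Nat.card_Icc, Nat.add_sub_cancel, nsmul_eq_mul,
    ← Finset.sum_filter, Finset.sum_const, nsmul_eq_mul]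
  gcongr
  have hsub : (Finset.Icc 1 K).filter (fun q : ℕ => (q : ℝ) < 6 / r) ⊆ Finset.Icc 1 ⌊6 / r⌋₊ :=
    fun q hq => by
      rw [Finset.mem_filter, Finset.mem_Icc] at hq
      exact Finset.mem_Icc.2 ⟨hq.1.1, Nat.le_floor hq.2.le⟩
  have := Finset.card_le_card hsub
  rw [Nat.card_Icc, Nat.add_sub_cancel] at this
  exact (Nat.cast_le.2 this).trans (Nat.floor_le (by positivity))

/-- The points near rational points of denominator at most `K`, at the scale given by Dirichlet's
theorem with parameter `H`. -/
theorem volume_small_denominators_le {m : ℕ} {r : ℝ} (hr : 0 < r) (hr1 : r ≤ 1) (K : ℕ) {H : ℕ}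
    (hH : 0 < H) (x : Fin m → ℝ) :
    volume (⋃ q ∈ Finset.Icc 1 K, ⋃ p ∈ intBox (fun i => (q : ℝ) * x i) (q * (r / 2) + 1),
      closedBall (fun i => (p i : ℝ) / q) (1 / (q * H))) ≤
      ENNReal.ofReal ((K * (3 * r) ^ m + 6 / r * 8 ^ m) / (H : ℝ) ^ m) := by
  have hH' : (0 : ℝ) < H := by exact_mod_cast hH
  calc _ ≤ ∑ q ∈ Finset.Icc 1 K, ENNReal.ofReal ((2 * r + 6 / (q : ℝ)) ^ m / (H : ℝ) ^ m) := by
        refine (measure_biUnion_finset_le _ _).trans (Finset.sum_le_sum fun q hq => ?_)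
        have hq0 : (0 : ℝ) < q := by exact_mod_cast (Finset.mem_Icc.1 hq).1
        refine (measure_biUnion_finset_le _ _).trans ?_
        simp_rw [Real.volume_pi_closedBall _ (show (0 : ℝ) ≤ 1 / (q * H) by positivity)]
        rw [Finset.sum_const, nsmul_eq_mul, ← ENNReal.ofReal_natCast,
          ← ENNReal.ofReal_mul (by positivity), Fintype.card_fin]
        refine ENNReal.ofReal_le_ofReal ?_
        calc _ ≤ (2 * (q * (r / 2) + 1) + 1) ^ m * (2 * (1 / ((q : ℝ) * H))) ^ m :=
              mul_le_mul_of_nonneg_right (card_intBox_le _ (by positivity)) (by positivity)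
          _ = _ := by rw [← mul_pow, ← div_pow]; congr 1; field_simp; ring
    _ = ENNReal.ofReal ((∑ q ∈ Finset.Icc 1 K, (2 * r + 6 / (q : ℝ)) ^ m) / (H : ℝ) ^ m) := by
        rw [← ENNReal.ofReal_sum_of_nonneg fun q _ => by positivity, Finset.sum_div]
    _ ≤ _ := ENNReal.ofReal_le_ofReal (by gcongr; exact sum_pow_le hr hr1 K)

/-- The rational points of denominator comparable to `H ^ m` contain, in each ball, a
`H ^ (-(m + 1))`-separated subset of the largest possible order of magnitude. -/
theorem exists_separated_rationals {m : ℕ} (hm : 0 < m) :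
    ∃ c > (0 : ℝ), ∃ ε > (0 : ℝ), ∀ r : ℝ, 0 < r → r ≤ 1 → ∀ᶠ H : ℕ in atTop,
      ∀ x : Fin m → ℝ, ∃ P : Finset (Fin m → ℝ),
        (∀ y ∈ P, dist y x ≤ r ∧ ∃ q : ℕ, ε * (H : ℝ) ^ m < q ∧ q ≤ H ^ m ∧
          ∃ p : Fin m → ℤ, y = fun i => (p i : ℝ) / q) ∧
        (∀ y ∈ P, ∀ z ∈ P, y ≠ z → 1 / (H : ℝ) ^ (m + 1) ≤ dist y z) ∧
        c * (r * (H : ℝ) ^ (m + 1)) ^ m ≤ P.card := by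
  -- Chosen so that `ε (3 r) ^ m = r ^ m / 4`: denominators up to `ε H ^ m` then cover at most half
  -- of the ball of radius `r / 2`, whose volume is `r ^ m`, the other quarter being the term made
  -- small by large `H`.
  set ε : ℝ := 1 / (4 * 3 ^ m) with hε
  have hε0 : 0 < ε := by positivity
  refine ⟨1 / (2 * (2 * (1 / ε + 1)) ^ m), by positivity, ε, hε0, fun r hr hr1 => ?_⟩
  have hcast : ∀ k : ℕ, k ≠ 0 → Tendsto (fun H : ℕ => (H : ℝ) ^ k) atTop atTop := fun k hk =>
    (tendsto_pow_atTop hk).comp tendsto_natCast_atTop_atTop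
  filter_upwards [eventually_gt_atTop 0,
    (hcast m hm.ne').eventually_ge_atTop (24 * 8 ^ m / (r * r ^ m)),
    (hcast (m + 1) (Nat.succ_ne_zero _)).eventually_ge_atTop (2 / (ε * r))] with H hH hH1 hH2 x
  have hH' : (0 : ℝ) < H := by exact_mod_cast hH
  set d : ℝ := 1 / (H : ℝ) ^ (m + 1) with hd
  have hd0 : 0 < d := by positivity
  have hdr : d / ε ≤ r / 2 := by
    rw [div_le_iff₀ (by positivity)] at hH2
    rw [hd, div_div, div_le_iff₀ (by positivity)]; linarith
  let S : Set (Fin m → ℝ) := {y | dist y x ≤ r ∧ ∃ q : ℕ, ε * (H : ℝ) ^ m < q ∧ q ≤ H ^ m ∧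
    ∃ p : Fin m → ℤ, y = fun i => (p i : ℝ) / q}
  have hS : S.Finite := by
    refine Set.Finite.subset (s := ⋃ q ∈ Finset.Icc 0 (H ^ m), (fun (p : Fin m → ℤ) i =>
      (p i : ℝ) / q) '' (intBox (fun i => (q : ℝ) * x i) (q * r))) (Set.Finite.biUnion
        (Finset.finite_toSet _) fun q _ => (Finset.finite_toSet _).image _) ?_
    rintro y ⟨hy, q, hq, hqH, p, rfl⟩
    have hq0 : (0 : ℝ) < q := lt_of_le_of_lt (by positivity) hq
    refine mem_iUnion₂.2 ⟨q, by simpa using hqH, p, mem_intBox.2 fun i => ?_, rfl⟩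
    have := (dist_le_pi_dist _ _ i).trans hy
    rw [Real.dist_eq] at this
    have e : (p i : ℝ) - q * x i = q * ((p i : ℝ) / q - x i) := by field_simp
    rw [e, abs_mul, abs_of_pos hq0]
    gcongr
  obtain ⟨P, hPS, hsep, hcov⟩ := exists_separated_subset hS.toFinset hd0
  refine ⟨P, fun y hy => hS.mem_toFinset.1 (hPS hy), hsep, ?_⟩
  set K : ℕ := ⌊ε * (H : ℝ) ^ m⌋₊ with hK
  -- Dirichlet puts each point within `1 / (q H)` of some `p / q` with `q ≤ H ^ m`. If `q > K`, this
  -- distance is at most `d / ε`, and `p / q` is within `d` of the net `P`.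
  have hsub : closedBall x (r / 2) ⊆
      (⋃ q ∈ Finset.Icc 1 K, ⋃ p ∈ intBox (fun i => (q : ℝ) * x i) (q * (r / 2) + 1),
        closedBall (fun i => (p i : ℝ) / q) (1 / (q * H))) ∪
      ⋃ z ∈ P, closedBall z (d / ε + d) := by
    intro y hy
    obtain ⟨q, hq, hqH, p, hp⟩ := exists_simultaneous_approx y hH
    have hq0 : (0 : ℝ) < q := by exact_mod_cast hq
    have hdist : dist y (fun i => (p i : ℝ) / q) ≤ 1 / (q * H) :=
      (dist_pi_le_iff (by positivity)).2 fun i => by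
        have e : (q : ℝ) * y i - p i = q * (y i - (p i : ℝ) / q) := by field_simp
        have := hp i
        rw [e, abs_mul, abs_of_pos hq0, le_div_iff₀ hH'] at this
        rw [Real.dist_eq, le_div_iff₀ (by positivity)]
        linarith
    rcases le_or_gt q K with hqK | hqK
    · refine Or.inl (mem_iUnion₂.2 ⟨q, Finset.mem_Icc.2 ⟨hq, hqK⟩, mem_iUnion₂.2
        ⟨p, mem_intBox.2 fun i => ?_, hdist⟩⟩)
      have h1 : |y i - x i| ≤ r / 2 := by
        have := (dist_le_pi_dist y x i).trans hy
        rwa [Real.dist_eq] at this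
      have h2 : (1 : ℝ) / H ≤ 1 := by
        rw [div_le_one hH']; exact_mod_cast hH
      have h3 : |(q : ℝ) * (y i - x i)| ≤ q * (r / 2) := by
        rw [abs_mul, abs_of_pos hq0]; gcongr
      have h4 := hp i
      rw [abs_le] at *
      constructor <;> linarith
    · have hq1 : ε * (H : ℝ) ^ m < q := Nat.lt_of_floor_lt hqK
      have h1 : 1 / ((q : ℝ) * H) ≤ d / ε := by
        rw [hd, div_div, pow_succ]
        refine one_div_le_one_div_of_le (by positivity) ?_
        nlinarith
      have hmem : (fun i => (p i : ℝ) / q) ∈ S := by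
        refine ⟨?_, q, hq1, hqH, p, rfl⟩
        have := dist_triangle_left (fun i => (p i : ℝ) / q) x y
        have := mem_closedBall.1 hy
        linarith
      obtain ⟨z, hz, hyz⟩ := hcov _ (hS.mem_toFinset.2 hmem)
      refine Or.inr (mem_iUnion₂.2 ⟨z, hz, ?_⟩)
      exact (dist_triangle _ _ _).trans (add_le_add (hdist.trans h1) hyz.le)
  have hvol := (measure_mono (μ := volume) hsub).trans (measure_union_le _ _)
  have hbad := volume_small_denominators_le hr hr1 K hH x
  have hgood : volume (⋃ z ∈ P, closedBall z (d / ε + d)) ≤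
      ENNReal.ofReal (P.card * (2 * (d / ε + d)) ^ m) := by
    refine (measure_biUnion_finset_le _ _).trans ?_
    simp_rw [Real.volume_pi_closedBall _ (show 0 ≤ d / ε + d by positivity)]
    rw [Finset.sum_const, nsmul_eq_mul, ← ENNReal.ofReal_natCast,
      ← ENNReal.ofReal_mul (by positivity), Fintype.card_fin]
  have h := hvol.trans (add_le_add hbad hgood)
  rw [Real.volume_pi_closedBall _ (by positivity), ← ENNReal.ofReal_add (by positivity)
    (by positivity), ENNReal.ofReal_le_ofReal_iff (by positivity), Fintype.card_fin,
    mul_div_cancel₀ r two_ne_zero] at h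
  have hKle : (K : ℝ) ≤ ε * (H : ℝ) ^ m := Nat.floor_le (by positivity)
  have hsmall : (K * (3 * r) ^ m + 6 / r * 8 ^ m) / (H : ℝ) ^ m ≤ r ^ m / 2 := by
    rw [div_le_iff₀ (by positivity)]
    have h1 : K * (3 * r) ^ m ≤ r ^ m / 4 * (H : ℝ) ^ m := by
      calc K * (3 * r) ^ m ≤ ε * (H : ℝ) ^ m * (3 * r) ^ m := by gcongr
        _ = _ := by rw [hε, mul_pow]; field_simp
    have h2 : 6 / r * 8 ^ m ≤ r ^ m / 4 * (H : ℝ) ^ m := by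
      rw [div_le_iff₀ (by positivity)] at hH1
      rw [div_mul_eq_mul_div, div_le_iff₀ hr]
      linarith
    linarith
  have hfin : r ^ m / 2 ≤ P.card * (2 * (d / ε + d)) ^ m := by linarith
  have e : (2 * (d / ε + d)) ^ m = (2 * (1 / ε + 1)) ^ m / ((H : ℝ) ^ (m + 1)) ^ m := by
    rw [← div_pow, hd]; congr 1; field_simp
  rw [e, ← mul_div_assoc, le_div_iff₀ (by positivity)] at hfin
  rw [mul_pow r, div_mul_eq_mul_div, one_mul, div_le_iff₀ (by positivity)]
  linarith

/-! ### Cantor sets from homogeneous trees. -/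

/-- The vertex at depth `k` on the branch `ω` of a tree of points. -/
def treePoint {E : Type*} {M : ℕ → ℕ} (x₀ : E) (child : ∀ k, E → Fin (M k) → E)
    (ω : ∀ k, Fin (M k)) : ℕ → E
  | 0 => x₀
  | k + 1 => child k (treePoint x₀ child ω k) (ω k)

/-- Interpolates between the trivial bound `1`, used for `t ≥ 1`, and the volume bound `A t ^ m`,
used for `t ≤ 1`. -/
theorem min_one_mul_pow_le {m : ℕ} {A t s : ℝ} (_hA : 0 < A) (ht : 0 < t) (hs0 : 0 ≤ s)
    (hs : s ≤ m) {y : ℝ} (h1 : y ≤ 1) (hy : y ≤ A * t ^ m) : y ≤ max 1 A * t ^ s := by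
  rcases le_total t 1 with h | h
  · have : t ^ m ≤ t ^ s := by
      rw [← Real.rpow_natCast]; exact Real.rpow_le_rpow_of_exponent_ge ht h hs
    calc y ≤ A * t ^ m := hy
      _ ≤ max 1 A * t ^ s := by gcongr; exact le_max_right _ _
  · have : 1 ≤ t ^ s := Real.one_le_rpow h hs0
    calc y ≤ 1 * 1 := by linarith
      _ ≤ max 1 A * t ^ s := by gcongr; exact le_max_left _ _

/-- A Cantor set construction in which all vertices of the same depth have the same number of
children: it carries points with dimension at least `s` when the children are separated and
sufficiently numerous. -/
theorem exists_le_dimH_range_of_tree {m : ℕ} (x₀ : Fin m → ℝ) {M : ℕ → ℕ} (hM : ∀ k, 0 < M k)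
    (child : ∀ k, (Fin m → ℝ) → Fin (M k) → Fin m → ℝ) {r d : ℕ → ℝ} (hr0 : ∀ k, 0 < r k)
    (hr : ∀ k, r (k + 1) ≤ r k / 2) (hd0 : ∀ k, 0 < d k) (hd : Antitone d)
    (hdlim : Tendsto d atTop (𝓝 0)) (hrd : ∀ k, r (k + 1) ≤ d k / 4)
    (hchild : ∀ k x j, dist (child k x j) x ≤ r k / 2)
    (hsep : ∀ k x i j, i ≠ j → d k ≤ dist (child k x i) (child k x j))
    {c s : ℝ} (hc : 0 < c) (hs0 : 0 < s) (hs : s ≤ m)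
    (hcard : ∀ k, c * (r k / d k) ^ m ≤ M k)
    (hmass : ∀ k, max 1 (5 ^ m / c) ≤ M k * r (k + 1) ^ s) :
    ∃ g : (∀ k, Fin (M k)) → Fin m → ℝ, (∀ ω k, dist (g ω) (treePoint x₀ child ω k) ≤ r k) ∧
      ENNReal.ofReal s ≤ dimH (range g) := by
  have hlim : ∀ ω, ∃ y, ∀ k, dist y (treePoint x₀ child ω k) ≤ r k := fun ω => by
    have := IsCompact.nonempty_iInter_of_sequence_nonempty_isCompact_isClosed
      (fun k => closedBall (treePoint x₀ child ω k) (r k))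
      (fun k => closedBall_subset_closedBall' (by
        have := hchild k (treePoint x₀ child ω k) (ω k)
        have := hr k
        simp only [treePoint]
        linarith))
      (fun k => ⟨_, mem_closedBall_self (hr0 k).le⟩) (isCompact_closedBall _ _)
      (fun k => isClosed_closedBall)
    obtain ⟨y, hy⟩ := this
    exact ⟨y, fun k => mem_iInter.1 hy k⟩
  choose g hg using hlim
  refine ⟨g, hg, ?_⟩
  have hne : ∀ k, Nonempty (Fin (M k)) := fun k => ⟨⟨0, hM k⟩⟩
  -- Independent uniform choices: each vertex splits its mass equally among its children.
  let μ : Measure (∀ k, Fin (M k)) :=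
    Measure.infinitePi fun k => ProbabilityTheory.uniformOn (univ : Set (Fin (M k)))
  -- Distinct children at depth `j ≤ k` are `d j ≥ d k` apart, and each limit is within `r (j + 1) ≤
  -- d j / 4` of its vertex. So branches with limits closer than `d k / 2` make the same choices up
  -- to index `k`.
  have hagree : ∀ (U : Set (Fin m → ℝ)) (ρ : ℝ) (k : ℕ), (∀ x ∈ U, ∀ y ∈ U, dist x y ≤ ρ) →
      ρ < d k / 2 → ∀ ω ∈ g ⁻¹' U, ∀ ω' ∈ g ⁻¹' U, ∀ j ≤ k + 1,
        treePoint x₀ child ω j = treePoint x₀ child ω' j ∧ ∀ i < j, ω i = ω' i := by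
    intro U ρ k hU hρ ω hω ω' hω' j
    induction j with
    | zero => exact fun _ => ⟨rfl, fun i hi => absurd hi (Nat.not_lt_zero _)⟩
    | succ j ih =>
      intro hj
      obtain ⟨h1, h2⟩ := ih (by omega)
      have h3 : ω j = ω' j := by
        by_contra hne
        have h4 := hsep j (treePoint x₀ child ω j) _ _ hne
        have h5 := hg ω (j + 1)
        have h6 := hg ω' (j + 1)
        simp only [treePoint] at h5 h6
        rw [← h1] at h6
        have h7 := hU _ hω _ hω'
        have h8 := hrd j
        have h9 := hd (show j ≤ k by omega)
        have := dist_triangle4 (child j (treePoint x₀ child ω j) (ω j)) (g ω) (g ω')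
          (child j (treePoint x₀ child ω j) (ω' j))
        rw [dist_comm _ (g ω)] at this
        linarith
      refine ⟨by simp only [treePoint, h1, h3], fun i hi => ?_⟩
      rcases Nat.lt_succ_iff_lt_or_eq.1 hi with hi | rfl
      exacts [h2 i hi, h3]
  have hbound : ∀ (U : Set (Fin m → ℝ)) (ρ : ℝ), 0 < ρ → ρ < d 0 / 2 →
      (∀ x ∈ U, ∀ y ∈ U, dist x y ≤ ρ) → μ (g ⁻¹' U) ≤ ENNReal.ofReal (ρ ^ s) := by
    intro U ρ hρ0 hρ hU
    rcases (g ⁻¹' U).eq_empty_or_nonempty with he | ⟨ω₀, hω₀⟩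
    · rw [he, measure_empty]; exact bot_le
    have hex : ∃ k, d k / 2 ≤ ρ := by
      obtain ⟨k, hk⟩ := (hdlim.eventually_lt_const hρ0).exists
      exact ⟨k, by linarith⟩
    classical
    obtain ⟨k, hk1, hk2⟩ : ∃ k, ρ < d k / 2 ∧ d (k + 1) / 2 ≤ ρ := by
      have h1 := Nat.find_spec hex
      have h2 : Nat.find hex ≠ 0 := fun h => by rw [h] at h1; linarith
      obtain ⟨k, hk⟩ := Nat.exists_eq_succ_of_ne_zero h2
      exact ⟨k, not_le.1 (Nat.find_min hex (by omega)), by rwa [hk] at h1⟩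
    let J : ∀ j, Finset (Fin (M j)) := fun j => Finset.univ.filter fun i => ∃ ω ∈ g ⁻¹' U, ω j = i
    -- Two coordinates suffice: index `k` is forced and yields the factor `1 / M k`, which `hmass`
    -- trades for `r (k + 1) ^ s`; index `k + 1` counts the children that `U` can meet.
    have hsub : g ⁻¹' U ⊆ Set.pi (({k, k + 1} : Finset ℕ) : Set ℕ) fun j => (J j : Set (Fin (M j))) :=
      fun ω hω j _ => by simpa [J] using ⟨ω, hω, rfl⟩
    have hJk : J k ⊆ {ω₀ k} := fun i hi => by
      obtain ⟨ω, hω, rfl⟩ := (Finset.mem_filter.1 hi).2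
      rw [Finset.mem_singleton]
      exact (hagree U ρ k hU hk1 ω hω ω₀ hω₀ (k + 1) le_rfl).2 k (Nat.lt_succ_self k)
    -- The factor 5 comes from `2 (ρ + r (k + 2)) + d (k + 1)`, with `r (k + 2) ≤ d (k + 1) / 4` and
    -- `d (k + 1) ≤ 2 ρ`.
    have hJk1 : ((J (k + 1)).card : ℝ) * d (k + 1) ^ m ≤ (5 * ρ) ^ m := by
      have := card_mul_pow_le_of_separated (J (k + 1))
        (child (k + 1) (treePoint x₀ child ω₀ (k + 1))) (hd0 (k + 1))
        (ρ := ρ + r (k + 2)) (by have := hr0 (k + 2); positivity) (g ω₀) (fun i hi => by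
          obtain ⟨ω, hω, rfl⟩ := (Finset.mem_filter.1 hi).2
          rw [← (hagree U ρ k hU hk1 ω hω ω₀ hω₀ (k + 1) le_rfl).1]
          have h1 := hg ω (k + 2)
          have h2 := hU _ hω _ hω₀
          have h3 := dist_triangle_left (treePoint x₀ child ω (k + 2)) (g ω₀) (g ω)
          simp only [treePoint] at h1 h3 ⊢
          linarith)
        (fun i _ j _ hij => hsep (k + 1) _ i j hij)
      refine this.trans (pow_le_pow_left₀ ?_ ?_ m)
      · have := hr0 (k + 2); have := hd0 (k + 1); positivity
      · have := hrd (k + 1); linarith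
    have hJM : ((J (k + 1)).card : ℝ) ≤ M (k + 1) := by
      have := Finset.card_le_univ (J (k + 1))
      rw [Fintype.card_fin] at this
      exact_mod_cast this
    have hMk : (0 : ℝ) < M k := by exact_mod_cast hM k
    have hMk1 : (0 : ℝ) < M (k + 1) := by exact_mod_cast hM (k + 1)
    have hrk := hr0 (k + 1)
    have hdk := hd0 (k + 1)
    have hfrac : ((J (k + 1)).card : ℝ) / M (k + 1) ≤ max 1 (5 ^ m / c) * (ρ / r (k + 1)) ^ s := by
      refine min_one_mul_pow_le (m := m) (by positivity) (by positivity) hs0.le hs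
        ((div_le_one hMk1).2 hJM) ?_
      have h1 := hcard (k + 1)
      calc ((J (k + 1)).card : ℝ) / M (k + 1)
          ≤ ((5 * ρ) ^ m / d (k + 1) ^ m) / (c * (r (k + 1) / d (k + 1)) ^ m) := by
            gcongr
            rwa [le_div_iff₀ (by positivity)]
        _ = _ := by rw [mul_pow, div_pow, div_pow]; field_simp
    have hreal : 1 / (M k : ℝ) * (((J (k + 1)).card : ℝ) / M (k + 1)) ≤ ρ ^ s := by
      rw [Real.div_rpow hρ0.le hrk.le, ← mul_div_assoc, le_div_iff₀ (by positivity)] at hfrac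
      rw [one_div_mul_eq_div, div_le_iff₀ hMk]
      have h2 := mul_le_mul_of_nonneg_right (hmass k) (show 0 ≤ ρ ^ s by positivity)
      refine le_of_mul_le_mul_right ?_ (show 0 < r (k + 1) ^ s by positivity)
      linarith
    calc μ (g ⁻¹' U) ≤ ∏ j ∈ ({k, k + 1} : Finset ℕ),
          ProbabilityTheory.uniformOn (univ : Set (Fin (M j))) (J j) := by
          rw [← Measure.infinitePi_pi _ fun j _ => (J j).measurableSet]
          exact measure_mono hsub
      _ ≤ ENNReal.ofReal (1 / (M k : ℝ)) *
          ENNReal.ofReal (((J (k + 1)).card : ℝ) / M (k + 1)) := by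
          rw [Finset.prod_pair (Nat.succ_ne_self k).symm]
          have hu : ∀ j, ProbabilityTheory.uniformOn (univ : Set (Fin (M j))) (J j) =
              ENNReal.ofReal (((J j).card : ℝ) / M j) := fun j => by
            rw [ProbabilityTheory.uniformOn_univ, Measure.count_apply_finset, Fintype.card_fin,
              ENNReal.ofReal_div_of_pos (by exact_mod_cast hM j), ENNReal.ofReal_natCast,
              ENNReal.ofReal_natCast]
          rw [hu, hu]
          gcongr
          exact_mod_cast (Finset.card_le_card hJk).trans (by simp)
      _ ≤ ENNReal.ofReal (ρ ^ s) := by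
          rw [← ENNReal.ofReal_mul (by positivity)]
          exact ENNReal.ofReal_le_ofReal hreal
  have hs' : ENNReal.ofReal s = ((s.toNNReal : ℝ≥0) : ℝ≥0∞) := rfl
  rw [hs']
  refine le_dimH_range_of_measure_preimage_le μ (by simp) g _ (ENNReal.ofReal (d 0 / 4))
    (ENNReal.ofReal_pos.2 (by have := hd0 0; positivity)) fun U hU => ?_
  rw [Real.coe_toNNReal s hs0.le]
  have hfin : ediam U ≠ ∞ := ne_top_of_le_ne_top ENNReal.ofReal_ne_top hU
  have hdiam : ∀ x ∈ U, ∀ y ∈ U, dist x y ≤ (ediam U).toReal := fun x hx y hy => by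
    rw [dist_edist]
    exact ENNReal.toReal_mono hfin (edist_le_ediam_of_mem hx hy)
  have hsmall : (ediam U).toReal < d 0 / 2 := by
    have h1 := ENNReal.toReal_mono ENNReal.ofReal_ne_top hU
    rw [ENNReal.toReal_ofReal (by have := hd0 0; positivity)] at h1
    linarith [hd0 0]
  -- The diameter may be zero, so the bound is applied to `ρ` slightly larger and passed to the
  -- limit.
  have hcont : Tendsto (fun ρ : ℝ => ENNReal.ofReal (ρ ^ s)) (𝓝[>] (ediam U).toReal)
      (𝓝 (ENNReal.ofReal ((ediam U).toReal ^ s))) :=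
    ((ENNReal.continuous_ofReal.comp (Real.continuous_rpow_const hs0.le)).tendsto _).mono_left
      nhdsWithin_le_nhds
  rw [← ENNReal.ofReal_rpow_of_nonneg ENNReal.toReal_nonneg hs0.le,
    ENNReal.ofReal_toReal hfin] at hcont
  refine ge_of_tendsto hcont ?_
  filter_upwards [Ioo_mem_nhdsGT hsmall] with ρ hρ
  exact hbound U ρ (ENNReal.toReal_nonneg.trans_lt hρ.1) hρ.2 fun x hx y hy =>
    (hdiam x hx y hy).trans hρ.1.le

/-! ### The Jarník–Besicovitch theorem. -/

theorem eventually_const_le_mul_natCast_rpow {a A δ : ℝ} (ha : 0 < a) (hδ : 0 < δ) :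
    ∀ᶠ H : ℕ in atTop, A ≤ a * (H : ℝ) ^ δ :=
  (((tendsto_rpow_atTop hδ).comp tendsto_natCast_atTop_atTop).const_mul_atTop
    ha).eventually_ge_atTop A

/-- Around a rational point with `q ≤ H ^ m`, the radius `R H = H ^ (-mτ) / 2` is below `1 / q ^ τ`.
With the previous scale `h` fixed, the number of children times `R H ^ s` grows at least like `H ^
(m (m + 1 - s τ))`, which is unbounded because `s τ < m + 1`. The condition `τ > 1 + 1 / m` makes `R
H` negligible against the separation `H ^ (-(m + 1))`. -/
theorem ofReal_le_dimH_approxSet_of_lt {m : ℕ} (hm : 0 < m) {τ : ℝ} (hτ : 1 + 1 / (m : ℝ) < τ)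
    {s : ℝ} (hs0 : 0 < s) (hs : s < (m + 1) / τ) :
    ENNReal.ofReal s ≤ dimH (approxSet τ m) := by
  have hm' : (0 : ℝ) < m := by exact_mod_cast hm
  have hmτ : (m : ℝ) + 1 < m * τ := by
    have := mul_lt_mul_of_pos_left hτ hm'
    rwa [mul_add, mul_one, mul_one_div_cancel hm'.ne'] at this
  have hτ0 : 0 < τ := by
    have : 0 < 1 / (m : ℝ) := by positivity
    linarith
  have hsτ : s * τ < m + 1 := (lt_div_iff₀ hτ0).1 hs
  have hsm : s ≤ m := by
    refine hs.le.trans ((div_le_iff₀ hτ0).2 hmτ.le)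
  obtain ⟨c, hc, ε, hε, hP⟩ := exists_separated_rationals hm
  let R : ℕ → ℝ := fun H => (H : ℝ) ^ (-(m * τ)) / 2
  have hR0 : ∀ H, 0 < H → 0 < R H := fun H hH => by
    have : (0 : ℝ) < H := by exact_mod_cast hH
    positivity
  have hR1 : ∀ H, 0 < H → R H ≤ 1 := fun H hH => by
    have h1 : (1 : ℝ) ≤ H := by exact_mod_cast hH
    have : (H : ℝ) ^ (-(m * τ)) ≤ 1 :=
      Real.rpow_le_one_of_one_le_of_nonpos h1 (by have : 0 < m * τ := by positivity
                                                  linarith)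
    simp only [R]; linarith
  have hRlim : Tendsto R atTop (𝓝 0) := by
    have := ((tendsto_rpow_neg_atTop (show 0 < m * τ by positivity)).comp
      tendsto_natCast_atTop_atTop).div_const 2
    rwa [zero_div] at this
  set A : ℝ := max 1 (5 ^ m / (c / 2 ^ m)) with hA
  have hnext : ∀ h : ℕ, ∃ H : ℕ, 0 < h → h < H ∧ R H ≤ R h / 2 ∧
      R H ≤ 1 / (H : ℝ) ^ (m + 1) / 4 ∧
      A ≤ c * (R h / 2 * (H : ℝ) ^ (m + 1)) ^ m * R H ^ s ∧
      ∀ x : Fin m → ℝ, ∃ P : Finset (Fin m → ℝ),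
        (∀ y ∈ P, dist y x ≤ R h / 2 ∧ ∃ q : ℕ, ε * (H : ℝ) ^ m < q ∧ q ≤ H ^ m ∧
          ∃ p : Fin m → ℤ, y = fun i => (p i : ℝ) / q) ∧
        (∀ y ∈ P, ∀ z ∈ P, y ≠ z → 1 / (H : ℝ) ^ (m + 1) ≤ dist y z) ∧
        c * (R h / 2 * (H : ℝ) ^ (m + 1)) ^ m ≤ P.card := by
    intro h
    rcases Nat.eq_zero_or_pos h with rfl | hh
    · exact ⟨0, fun h => absurd h (lt_irrefl 0)⟩
    have hRh := hR0 h hh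
    have e1 : ∀ᶠ H : ℕ in atTop, R H ≤ 1 / (H : ℝ) ^ (m + 1) / 4 := by
      filter_upwards [eventually_const_le_mul_natCast_rpow (A := 2) one_pos (sub_pos.2 hmτ),
        eventually_gt_atTop 0] with H h1 h2
      have h2' : (0 : ℝ) < H := by exact_mod_cast h2
      rw [one_mul, Real.rpow_sub h2'] at h1
      have h3 : (H : ℝ) ^ ((m : ℝ) + 1) = (H : ℝ) ^ (m + 1) := by
        rw [← Real.rpow_natCast]; norm_cast
      rw [h3, le_div_iff₀ (by positivity)] at h1
      simp only [R]
      rw [Real.rpow_neg h2'.le, div_div, inv_eq_one_div, div_div]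
      exact one_div_le_one_div_of_le (by positivity) (by linarith)
    have e2 : ∀ᶠ H : ℕ in atTop, A ≤ c * (R h / 2 * (H : ℝ) ^ (m + 1)) ^ m * R H ^ s := by
      filter_upwards [eventually_const_le_mul_natCast_rpow (A := A)
        (show 0 < c * (R h / 2) ^ m / 2 ^ s by positivity)
        (show 0 < (m : ℝ) * (m + 1 - s * τ) from mul_pos hm' (by linarith)),
        eventually_gt_atTop 0] with H h1 h2
      have h2' : (0 : ℝ) < H := by exact_mod_cast h2
      refine h1.trans (le_of_eq ?_)
      simp only [R]
      rw [Real.div_rpow (by positivity) (by norm_num), ← Real.rpow_mul h2'.le, mul_pow, ← pow_mul]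
      have h3 : (H : ℝ) ^ ((m : ℝ) * (m + 1 - s * τ)) =
          (H : ℝ) ^ ((m + 1) * m) * (H : ℝ) ^ (-(m * τ) * s) := by
        rw [← Real.rpow_natCast, ← Real.rpow_add h2']
        congr 1
        push_cast
        ring
      rw [h3]
      ring
    obtain ⟨H, h1, h2, h3, h4, h5⟩ := ((eventually_gt_atTop h).and
      ((hRlim.eventually_le_const (half_pos hRh)).and (e1.and (e2.and
      (hP (R h / 2) (half_pos hRh) (by linarith [hR1 h hh])))))).exists
    exact ⟨H, fun _ => ⟨h1, h2, h3, h4, h5⟩⟩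
  choose F hF using hnext
  let S : ℕ → ℕ := fun k => F^[k] 1
  have hS : ∀ k, S (k + 1) = F (S k) := fun k => Function.iterate_succ_apply' F k 1
  have hSpos : ∀ k, 0 < S k := fun k => by
    induction k with
    | zero => exact one_pos
    | succ k ih => rw [hS]; exact ih.trans (hF _ ih).1
  have hstep : ∀ k, _ := fun k => hF (S k) (hSpos k)
  simp only [← hS] at hstep
  have hSmono : StrictMono S := strictMono_nat_of_lt_succ fun k => (hstep k).1
  have hSpos' : ∀ k, (0 : ℝ) < S k := fun k => by exact_mod_cast hSpos k
  let N : ℕ → ℝ := fun k => c * (R (S k) / 2 * (S (k + 1) : ℝ) ^ (m + 1)) ^ m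
  have hN : ∀ k, 0 < N k := fun k => by
    have := hR0 _ (hSpos k)
    have := hSpos' (k + 1)
    positivity
  -- Only `⌈N k⌉₊` of the available points are kept, so that all vertices of one depth have equally
  -- many children.
  let M : ℕ → ℕ := fun k => ⌈N k⌉₊
  have hchild : ∀ k (x : Fin m → ℝ), ∃ f : Fin (M k) → Fin m → ℝ,
      (∀ j, dist (f j) x ≤ R (S k) / 2 ∧ ∃ q : ℕ, ε * (S (k + 1) : ℝ) ^ m < q ∧
        q ≤ S (k + 1) ^ m ∧ ∃ p : Fin m → ℤ, f j = fun i => (p i : ℝ) / q) ∧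
      ∀ i j, i ≠ j → 1 / (S (k + 1) : ℝ) ^ (m + 1) ≤ dist (f i) (f j) := fun k x => by
    obtain ⟨P, h1, h2, h3⟩ := (hstep k).2.2.2.2 x
    obtain ⟨f⟩ : Nonempty (Fin (M k) ↪ P) := Function.Embedding.nonempty_of_card_le (by
      rw [Fintype.card_fin, Fintype.card_coe]
      exact Nat.ceil_le.2 h3)
    exact ⟨fun j => f j, fun j => h1 _ (f j).2, fun i j hij => h2 _ (f i).2 _ (f j).2
      fun h => hij (f.injective (Subtype.ext h))⟩
  choose child hc1 hc2 using hchild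
  have hSlim : Tendsto (fun k => S (k + 1)) atTop atTop :=
    hSmono.tendsto_atTop.comp (tendsto_add_atTop_nat 1)
  have hSlim' : ∀ j : ℕ, j ≠ 0 → Tendsto (fun k => (S (k + 1) : ℝ) ^ j) atTop atTop := fun j hj =>
    (tendsto_pow_atTop hj).comp (tendsto_natCast_atTop_atTop.comp hSlim)
  obtain ⟨g, hg, hdim⟩ := exists_le_dimH_range_of_tree (m := m) 0 (M := M)
    (fun k => Nat.ceil_pos.2 (hN k)) child (r := fun k => R (S k))
    (d := fun k => 1 / (S (k + 1) : ℝ) ^ (m + 1)) (fun k => hR0 _ (hSpos k))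
    (fun k => (hstep k).2.1) (fun k => by have := hSpos' (k + 1); positivity)
    (antitone_nat_of_succ_le fun k => by
      have := hSpos' (k + 1)
      have := hSmono.monotone (Nat.le_succ (k + 1))
      exact one_div_le_one_div_of_le (by positivity) (by gcongr))
    (by simp only [one_div]; exact (hSlim' (m + 1) (Nat.succ_ne_zero m)).inv_tendsto_atTop)
    (fun k => (hstep k).2.2.1) (fun k x j => (hc1 k x j).1) hc2
    (c := c / 2 ^ m) (s := s) (by positivity) hs0 hsm
    (fun k => by
      refine le_trans (le_of_eq ?_) (Nat.le_ceil (N k))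
      have := hSpos' (k + 1)
      simp only [N]
      generalize R (S k) = ρ
      rw [div_div_eq_mul_div, div_one, mul_pow, mul_pow, div_pow]
      field_simp)
    (fun k => (hstep k).2.2.2.1.trans (by
      have := hR0 _ (hSpos (k + 1))
      exact mul_le_mul_of_nonneg_right (Nat.le_ceil (N k)) (by positivity)))
  refine hdim.trans (dimH_mono ?_)
  rintro _ ⟨ω, rfl⟩
  refine Set.infinite_of_forall_exists_gt fun a => ?_
  -- The lower bound `q > ε S (k + 1) ^ m` forces unbounded, hence infinitely many, denominators.
  obtain ⟨k, hk⟩ := (((hSlim' m hm.ne').const_mul_atTop hε).eventually_ge_atTop (a : ℝ)).exists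
  obtain ⟨-, q, hq1, hq2, p, hp⟩ := hc1 k (treePoint 0 child ω k) (ω k)
  have hq0 : (0 : ℝ) < q := (Nat.cast_nonneg a).trans_lt (hk.trans_lt hq1)
  refine ⟨q, ⟨by exact_mod_cast hq0, p, fun i => ?_⟩, by exact_mod_cast hk.trans_lt hq1⟩
  have h1 := (dist_le_pi_dist _ _ i).trans (hg ω (k + 1))
  have h2 : treePoint 0 child ω (k + 1) = fun i => (p i : ℝ) / q := hp
  rw [h2, Real.dist_eq] at h1
  refine h1.trans_lt ?_
  have h3 : (q : ℝ) ≤ (S (k + 1) : ℝ) ^ m := by exact_mod_cast hq2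
  have h4 := hSpos' (k + 1)
  have h5 : (0 : ℝ) < (S (k + 1) : ℝ) ^ (-(m * τ)) := by positivity
  calc R (S (k + 1)) < (S (k + 1) : ℝ) ^ (-(m * τ)) := half_lt_self h5
    _ = 1 / ((S (k + 1) : ℝ) ^ m) ^ τ := by
        rw [Real.rpow_neg h4.le, ← Real.rpow_natCast, ← Real.rpow_mul h4.le, one_div]
    _ ≤ 1 / (q : ℝ) ^ τ := one_div_le_one_div_of_le (by positivity)
        (Real.rpow_le_rpow hq0.le h3 hτ0.le)

/-- The lower bound in the theorem of Jarník and Besicovitch. -/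
theorem ofReal_le_dimH_approxSet {m : ℕ} (hm : 0 < m) {τ : ℝ} (hτ : 1 + 1 / (m : ℝ) < τ) :
    ENNReal.ofReal ((m + 1) / τ) ≤ dimH (approxSet τ m) := by
  have hτ0 : 0 < τ := by
    have : 0 ≤ 1 / (m : ℝ) := by positivity
    linarith
  have hpos : 0 < ((m : ℝ) + 1) / τ := by positivity
  have hcont : Tendsto ENNReal.ofReal (𝓝[<] (((m : ℝ) + 1) / τ))
      (𝓝 (ENNReal.ofReal ((m + 1) / τ))) :=
    (ENNReal.continuous_ofReal.tendsto _).mono_left nhdsWithin_le_nhds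
  refine le_of_tendsto hcont ?_
  filter_upwards [Ioo_mem_nhdsLT hpos] with s hs
  exact ofReal_le_dimH_approxSet_of_lt hm hτ hs.1 hs.2

theorem dimH_approxSet_le (n : ℕ) {τ : ℝ} (hτ : 0 < τ) :
    dimH (approxSet τ n) ≤ ENNReal.ofReal ((n + 1) / τ) := by
  have hcont : Tendsto (fun ν : ℝ => ENNReal.ofReal ((n + ν) / τ)) (𝓝[>] 1)
      (𝓝 (ENNReal.ofReal ((n + 1) / τ))) :=
    ((ENNReal.continuous_ofReal.comp (by fun_prop : Continuous fun ν : ℝ =>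
      (n + ν) / τ)).tendsto _).mono_left nhdsWithin_le_nhds
  refine ge_of_tendsto hcont ?_
  filter_upwards [self_mem_nhdsWithin] with ν hν
  have hν1 : (1 : ℝ) < ν := hν
  exact dimH_approxSetIn_le n hτ (fun q hq => hq) (one_pos.trans hν1)
    ((Real.summable_nat_rpow.2 (neg_lt_neg hν1)).subtype _)

/-! ### Approximable points on rational hyperplanes. -/

theorem finite_setOf_natCast_rpow_le {δ : ℝ} (hδ : 0 < δ) (B : ℝ) :
    {q : ℕ | (q : ℝ) ^ δ ≤ B}.Finite := by
  have h := ((tendsto_rpow_atTop hδ).comp tendsto_natCast_atTop_atTop).eventually_gt_atTop B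
  rw [← Nat.cofinite_eq_atTop] at h
  exact h.subset fun q (hq : (q : ℝ) ^ δ ≤ B) => (not_lt.2 hq : ¬ B < (q : ℝ) ^ δ)

/-- For `q ∈ Q` the integer `u q - v ∑ aᵢ pᵢ` is nonzero, since otherwise `v ∣ q`. Being also at
most `v (∑ aᵢ) q ^ (1 - τ)` in absolute value, it bounds `q`. -/
theorem rationalHyperplane_inter_approxSet_subset {Q : Set ℕ} (hQ : ∀ q ∈ Q, 0 < q)
    (hQfree : IsComplementFree Q) {n : ℕ} {τ : ℝ} (hτ : 1 < τ) (a : Fin n → ℕ) {u v : ℕ}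
    (hv : 0 < v) (huv : Nat.Coprime u v) (hvQ : v ∉ Q) :
    rationalHyperplane a u v ∩ approxSet τ n ⊆ approxSetStar τ n Q := by
  rintro x ⟨hx, hxW⟩
  refine ⟨hxW, not_infinite.2 ?_⟩
  refine (finite_setOf_natCast_rpow_le (sub_pos.2 hτ) (v * ∑ i, (a i : ℝ))).subset ?_
  rintro q ⟨hq, p, hp⟩
  have hq0 := hQ q hq
  have hq0' : (0 : ℝ) < q := by exact_mod_cast hq0
  have hv' : (0 : ℝ) < v := by exact_mod_cast hv
  have hne : (u : ℤ) * q - v * ∑ i, (a i : ℤ) * p i ≠ 0 := fun h => by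
    have h1 : (v : ℤ) ∣ (u : ℤ) * q := ⟨_, sub_eq_zero.1 h⟩
    have h2 : v ∣ u * q := by exact_mod_cast h1
    exact (hQfree q hq0).1 hq v hv hvQ (huv.symm.dvd_of_dvd_mul_left h2)
  have h1 : (1 : ℝ) ≤ |(u : ℝ) * q - v * ∑ i, (a i : ℝ) * p i| := by
    have := Int.one_le_abs hne
    exact_mod_cast this
  have hx' : ∑ i, (a i : ℝ) * x i = u / v := hx
  have h2 : (u : ℝ) * q - v * ∑ i, (a i : ℝ) * p i =
      v * q * ∑ i, (a i : ℝ) * (x i - p i / q) := by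
    simp only [mul_sub, Finset.sum_sub_distrib, hx']
    have : ∑ i, (a i : ℝ) * (p i / q) = (∑ i, (a i : ℝ) * p i) / q := by
      rw [Finset.sum_div]; simp only [mul_div_assoc]
    rw [this]
    field_simp
  have h3 : |∑ i, (a i : ℝ) * (x i - p i / q)| ≤ (∑ i, (a i : ℝ)) * (1 / (q : ℝ) ^ τ) := by
    refine (Finset.abs_sum_le_sum_abs _ _).trans ?_
    rw [Finset.sum_mul]
    refine Finset.sum_le_sum fun i _ => ?_
    rw [abs_mul, Nat.abs_cast]
    exact mul_le_mul_of_nonneg_left (hp i).le (Nat.cast_nonneg _)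
  rw [h2, abs_mul, abs_of_pos (by positivity)] at h1
  have h4 := h1.trans (mul_le_mul_of_nonneg_left h3 (by positivity))
  change (q : ℝ) ^ (τ - 1) ≤ _
  rw [Real.rpow_sub hq0', Real.rpow_one, div_le_iff₀ hq0']
  have hqτ : 0 < (q : ℝ) ^ τ := by positivity
  rw [mul_one_div, ← mul_div_assoc, le_div_iff₀ hqτ] at h4
  linarith

/-- Solving for a coordinate with `a i₀ ≠ 0` parametrizes the hyperplane by the others, and the
Lipschitz projection recovers them. A denominator `q` for `y` becomes `a i₀ * v * q` for the lifted
point; the gap `τ < τ'` absorbs the constants lost. -/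
theorem dimH_approxSet_le_dimH_rationalHyperplane {m : ℕ} {τ τ' : ℝ} (hτ : τ < τ')
    (a : Fin (m + 1) → ℕ) (ha : a ≠ 0) (u : ℕ) {v : ℕ} (hv : 0 < v) :
    dimH (approxSet τ' m) ≤ dimH (rationalHyperplane a u v ∩ approxSet τ (m + 1)) := by
  obtain ⟨i₀, hi₀⟩ := Function.ne_iff.1 ha
  have ha₀ : 0 < a i₀ := Nat.pos_of_ne_zero hi₀
  have ha₀' : (0 : ℝ) < a i₀ := by exact_mod_cast ha₀
  have ha1 : (1 : ℝ) ≤ a i₀ := by exact_mod_cast ha₀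
  have hv' : (0 : ℝ) < v := by exact_mod_cast hv
  let b : Fin m → ℕ := fun j => a (i₀.succAbove j)
  let φ : (Fin m → ℝ) → Fin (m + 1) → ℝ := fun y =>
    i₀.insertNth ((u / v - ∑ j, (b j : ℝ) * y j) / a i₀) y
  let π : (Fin (m + 1) → ℝ) → Fin m → ℝ := fun x j => x (i₀.succAbove j)
  have hπ : LipschitzWith 1 π := LipschitzWith.of_dist_le_mul fun x y => by
    rw [NNReal.coe_one, one_mul]
    exact (dist_pi_le_iff dist_nonneg).2 fun j => dist_le_pi_dist x y _
  have hπφ : π '' (φ '' approxSet τ' m) = approxSet τ' m := by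
    rw [← image_comp]
    have : π ∘ φ = id := by ext y j; simp [π, φ]
    rw [this, image_id]
  rw [← hπφ]
  refine (hπ.dimH_image_le _).trans (dimH_mono ?_)
  rintro _ ⟨y, hy, rfl⟩
  refine ⟨?_, ?_⟩
  · change ∑ i, (a i : ℝ) * φ y i = u / v
    rw [Fin.sum_univ_succAbove _ i₀]
    simp only [φ, Fin.insertNth_apply_same, Fin.insertNth_apply_succAbove]
    rw [mul_div_cancel₀ _ ha₀'.ne']
    simp [b]
  set D : ℕ := a i₀ * v with hD
  have hD0 : 0 < D := Nat.mul_pos ha₀ hv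
  have hD0' : (0 : ℝ) < D := by exact_mod_cast hD0
  set A : ℝ := ∑ j, (b j : ℝ) with hA
  have hA0 : 0 ≤ A := Finset.sum_nonneg fun j _ => Nat.cast_nonneg _
  have hinf := Set.Infinite.sdiff hy
    (finite_setOf_natCast_rpow_le (sub_pos.2 hτ) ((A + 1) * (D : ℝ) ^ τ))
  refine (hinf.image (f := fun q => D * q) fun q _ q' _ h => Nat.eq_of_mul_eq_mul_left hD0 h).mono ?_
  rintro _ ⟨q, ⟨⟨hq, p, hp⟩, hlarge⟩, rfl⟩
  have hq0 : 0 < q := hq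
  have hq' : (0 : ℝ) < q := by exact_mod_cast hq0
  have hlarge' : (A + 1) * (D : ℝ) ^ τ < (q : ℝ) ^ (τ' - τ) := not_le.1 hlarge
  have hbound : (A + 1) * (1 / (q : ℝ) ^ τ') < 1 / ((D : ℝ) * q) ^ τ := by
    rw [Real.rpow_sub hq', lt_div_iff₀ (by positivity)] at hlarge'
    rw [Real.mul_rpow hD0'.le hq'.le, mul_one_div,
      div_lt_div_iff₀ (by positivity) (by positivity)]
    linarith
  have hqτ : 0 < 1 / (q : ℝ) ^ τ' := by positivity
  refine ⟨Nat.mul_pos hD0 hq0, i₀.insertNth ((u : ℤ) * q - v * ∑ j, (b j : ℤ) * p j)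
    fun j => (D : ℤ) * p j, fun i => ?_⟩
  push_cast
  refine lt_of_le_of_lt ?_ hbound
  rcases Fin.eq_self_or_eq_succAbove i₀ i with rfl | ⟨j, rfl⟩
  · simp only [φ, Fin.insertNth_apply_same]
    push_cast
    have e : (u / v - ∑ j, (b j : ℝ) * y j) / a i -
        (u * q - v * ∑ j, (b j : ℝ) * p j) / (D * q) =
          -(∑ j, (b j : ℝ) * (y j - p j / q)) / a i := by
      have : ∑ j, (b j : ℝ) * (p j / q) = (∑ j, (b j : ℝ) * p j) / q := by
        rw [Finset.sum_div]; simp only [mul_div_assoc]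
      simp only [mul_sub, Finset.sum_sub_distrib, this, hD]
      push_cast
      field_simp
      ring
    rw [e, abs_div, abs_neg, Nat.abs_cast]
    refine (div_le_self (abs_nonneg _) ha1).trans ?_
    calc |∑ j, (b j : ℝ) * (y j - p j / q)| ≤ ∑ j, (b j : ℝ) * (1 / (q : ℝ) ^ τ') := by
          refine (Finset.abs_sum_le_sum_abs _ _).trans (Finset.sum_le_sum fun j _ => ?_)
          rw [abs_mul, Nat.abs_cast]
          exact mul_le_mul_of_nonneg_left (hp j).le (Nat.cast_nonneg _)
      _ = A * (1 / (q : ℝ) ^ τ') := by rw [hA, Finset.sum_mul]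
      _ ≤ _ := by linarith
  · simp only [φ, Fin.insertNth_apply_succAbove]
    push_cast
    rw [mul_div_mul_left _ _ hD0'.ne']
    refine (hp j).le.trans ?_
    have := mul_nonneg hA0 hqτ.le
    linarith

theorem ofReal_le_dimH_rationalHyperplane {m : ℕ} (hm : 0 < m) {τ : ℝ}
    (hτ : 1 + 1 / (m : ℝ) < τ) (a : Fin (m + 1) → ℕ) (ha : a ≠ 0) (u : ℕ) {v : ℕ} (hv : 0 < v) :
    ENNReal.ofReal ((m + 1) / τ) ≤ dimH (rationalHyperplane a u v ∩ approxSet τ (m + 1)) := by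
  have hτ0 : 0 < τ := by
    have : 0 ≤ 1 / (m : ℝ) := by positivity
    linarith
  have hcont : Tendsto (fun t : ℝ => ENNReal.ofReal ((m + 1) / t)) (𝓝[>] τ)
      (𝓝 (ENNReal.ofReal ((m + 1) / τ))) :=
    (ENNReal.continuous_ofReal.tendsto _).comp
      ((tendsto_const_nhds.div tendsto_id hτ0.ne').mono_left nhdsWithin_le_nhds)
  refine le_of_tendsto hcont ?_
  filter_upwards [self_mem_nhdsWithin] with t ht
  exact (ofReal_le_dimH_approxSet hm (hτ.trans ht)).trans
    (dimH_approxSet_le_dimH_rationalHyperplane ht a ha u hv)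

/-! ### Removing a set of smaller dimension, and conclusion. -/

/-- The dimension of a union is the maximum, and `W(Q)` has dimension strictly below that of `W`, so
`W*` must carry the full dimension. -/
theorem ofReal_le_dimH_approxSetStar {Q : Set ℕ} (hQ : ∀ q ∈ Q, 0 < q)
    (hν : convergenceExponent Q < 1) {n : ℕ} (hn : 0 < n) {τ : ℝ} (hτ : 1 + 1 / (n : ℝ) < τ) :
    ENNReal.ofReal ((n + 1) / τ) ≤ dimH (approxSetStar τ n Q) := by
  have hτ0 : 0 < τ := by
    have : 0 ≤ 1 / (n : ℝ) := by positivity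
    linarith
  -- Nonemptiness lets an infimum below 1 produce an actual admissible exponent below 1; the
  -- exponent 2 is always admissible.
  have hne : {ν : ℝ | 0 < ν ∧ Summable fun q : Q => ((q : ℕ) : ℝ) ^ (-ν)}.Nonempty :=
    ⟨2, two_pos, (Real.summable_nat_rpow.2 (by norm_num : (-2 : ℝ) < -1)).subtype Q⟩
  obtain ⟨ν, ⟨hν0, hsum⟩, hν1⟩ := exists_lt_of_csInf_lt hne hν
  have hlt : dimH (approxSetIn τ n Q) < ENNReal.ofReal ((n + 1) / τ) := by
    refine (dimH_approxSetIn_le n hτ0 hQ hν0 hsum).trans_lt ?_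
    rw [ENNReal.ofReal_lt_ofReal_iff (by positivity)]
    gcongr
  have h := (ofReal_le_dimH_approxSet hn hτ).trans (dimH_mono (s := approxSet τ n)
    (t := approxSetStar τ n Q ∪ approxSetIn τ n Q) (by simp [approxSetStar]))
  rw [dimH_union] at h
  exact (le_max_iff.1 h).resolve_right (not_le.2 hlt)

theorem theorem1 (Q : Set ℕ) (hQinf : Q.Infinite) (hQproper : Q ⊂ {q : ℕ | 0 < q})
    (hQfree : IsComplementFree Q) (n : ℕ) (hn : 1 ≤ n) (τ : ℝ) :
    (convergenceExponent Q < 1 → 1 + 1 / (n : ℝ) < τ →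
      dimH (approxSetStar τ n Q) = ENNReal.ofReal (((n : ℝ) + 1) / τ)) ∧
    (convergenceExponent Q = 1 → 2 ≤ n → 1 + 1 / ((n : ℝ) - 1) < τ →
      ENNReal.ofReal ((n : ℝ) / τ) ≤ dimH (approxSetStar τ n Q) ∧
      dimH (approxSetStar τ n Q) ≤ ENNReal.ofReal (((n : ℝ) + 1) / τ)) ∧
    (2 ≤ n → 1 + 1 / ((n : ℝ) - 1) < τ →
      ∀ (a : Fin n → ℕ) (u v : ℕ), a ≠ 0 → 0 < u → 0 < v → Nat.Coprime u v → v ∉ Q →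
        rationalHyperplane a u v ∩ approxSet τ n ⊆ approxSetStar τ n Q ∧
        ENNReal.ofReal ((n : ℝ) / τ) ≤ dimH (rationalHyperplane a u v ∩ approxSet τ n)) := by
  have hQ : ∀ q ∈ Q, 0 < q := fun q hq => hQproper.1 hq
  have hupper : 0 < τ → dimH (approxSetStar τ n Q) ≤ ENNReal.ofReal (((n : ℝ) + 1) / τ) :=
    fun hτ0 => (dimH_mono sdiff_subset).trans (dimH_approxSet_le n hτ0)
  have hplane : 2 ≤ n → 1 + 1 / ((n : ℝ) - 1) < τ → 1 < τ ∧
      ∀ (a : Fin n → ℕ) (u v : ℕ), a ≠ 0 → 0 < v → Nat.Coprime u v → v ∉ Q →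
        rationalHyperplane a u v ∩ approxSet τ n ⊆ approxSetStar τ n Q ∧
        ENNReal.ofReal ((n : ℝ) / τ) ≤ dimH (rationalHyperplane a u v ∩ approxSet τ n) := by
    intro hn2 hτ
    obtain ⟨m, rfl⟩ : ∃ m, n = m + 1 := ⟨n - 1, by omega⟩
    have hm : 0 < m := by omega
    have hτ' : 1 + 1 / (m : ℝ) < τ := by simpa using hτ
    have hτ1 : 1 < τ := by
      have : 0 ≤ 1 / (m : ℝ) := by positivity
      linarith
    refine ⟨hτ1, fun a u v ha hv huv hvQ =>
      ⟨rationalHyperplane_inter_approxSet_subset hQ hQfree hτ1 a hv huv hvQ, ?_⟩⟩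
    simpa using ofReal_le_dimH_rationalHyperplane hm hτ' a ha u hv
  refine ⟨fun hν hτ => ?_, fun _ hn2 hτ => ?_, fun hn2 hτ a u v ha _ => (hplane hn2 hτ).2 a u v ha⟩
  · have hτ0 : 0 < τ := by
      have : 0 ≤ 1 / (n : ℝ) := by positivity
      linarith
    exact le_antisymm (hupper hτ0) (ofReal_le_dimH_approxSetStar hQ hν hn hτ)
  · obtain ⟨hτ1, H⟩ := hplane hn2 hτ
    obtain ⟨v, hv, hvQ⟩ := exists_of_ssubset hQproper
    -- The hyperplane `∑ xᵢ = 1 / v` serves for any `v` outside `Q`, coprimality being automatic.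
    obtain ⟨h1, h2⟩ := H (fun _ => 1) 1 v
      (fun h => one_ne_zero (congrFun h ⟨0, hn⟩)) hv (Nat.coprime_one_left v) hvQ
    exact ⟨h2.trans (dimH_mono h1), hupper (one_pos.trans hτ1)⟩
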